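/- Let $n\ge 1$ be an integer. There is exactly one function $r\in C^2[0,\infty)$ (one-sided derivatives at $0$) with $r'(t)^2\neq 1$ for all $t>0$ that solves the singular initial value problem $$\frac{r''(t)}{1-(r'(t))^2}+\frac{n-1}{t}\,r'(t)=1\quad (t\in(0,\infty)),\qquad r(0)=r'(0)=0 .$$ Call a $C^2$ function $u:\mathbb R^n\to\mathbb R$ a spacelike soliton solution if $$\operatorname{div}\Big(\frac{\nabla u}{\sqrt{1-|\nabla u|^2}}\Big)=\frac1{\sqrt{1-|\nabla u|^2}}\quad\text{and}\quad |\nabla u|<1\quad\text{on }\mathbb R^n,$$ and call $u$ radially symmetric with vertex $x_0$ if $u(x)$ depends only on $|x-x_0|$. Every spacelike soliton solution $u$ that is radially symmetric with vertex $x_0$ satisfies $$u(x)=r(|x-x_0|)+u(x_0)\qquad\text{for all }x\in\mathbb R^n ,$$ and conversely $x\mapsto r(|x-x_0|)+c$ is a spacelike soliton solution for all $x_0\in\mathbb R^n$, $c\in\mathbb R$. Moreover $r\in C^\infty[0,\infty)$, and for all $t\in[0,\infty)$ $$\frac{t}{\sqrt{n^2+t^2}}\le r'(t)<1,\qquad 0<r''(t)\le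 1 .$$ Consequently, let $u$ be a radially symmetric (with some vertex) spacelike translating soliton of the mean curvature flow in Minkowski space, that is, $V(x,t)=u(x)+t$ is $C^2$ in $x$ with $|\nabla V|<1$ and $$\frac{\partial V}{\partial t}=\sqrt{1-|\nabla V|^2}\,\operatorname{div}\Big(\frac{\nabla V}{\sqrt{1-|\nabla V|^2}}\Big)\quad\text{on }\mathbb R^n\times\mathbb R .$$ Then $u$ is $C^\infty$ on $\mathbb R^n$, strictly convex with everywhere positive definite Hessian, and of linear growth, namely $u(x)/|x|\to1$ as $|x|\to\infty$. Any two such solitons $u,w$ differ by a translation of $\mathbb R^{n+1}$: there are $a\in\mathbb R^n$, $c\in\mathbb R$ with $w(x)=u(x-a)+c$ for all $x$. -/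

import Mathlib

open Set Filter Topology

open scoped ContDiff Gradient

noncomputable section

/-- Divergence of a vector field on `ℝⁿ`: the sum of the partial derivatives `∂ᵢ Fᵢ`. -/
def euclideanDiv {n : ℕ} (F : EuclideanSpace ℝ (Fin n) → EuclideanSpace ℝ (Fin n))
    (x : EuclideanSpace ℝ (Fin n)) : ℝ :=
  ∑ i : Fin n, (fderiv ℝ F x (EuclideanSpace.single i 1)) i

/-- The vector field `∇u / √(1 - |∇u|²)`. -/
def lorentzField {n : ℕ} (u : EuclideanSpace ℝ (Fin n) → ℝ)
    (x : EuclideanSpace ℝ (Fin n)) : EuclideanSpace ℝ (Fin n) :=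
  (Real.sqrt (1 - ‖∇ u x‖ ^ 2))⁻¹ • ∇ u x

/-- `u` is an entire `C²` spacelike solution of
`div (∇u / √(1 - |∇u|²)) = 1 / √(1 - |∇u|²)`. -/
structure IsSolitonSolution {n : ℕ} (u : EuclideanSpace ℝ (Fin n) → ℝ) : Prop where
  contDiff : ContDiff ℝ 2 u
  spacelike : ∀ x, ‖∇ u x‖ < 1
  equation : ∀ x, euclideanDiv (lorentzField u) x = 1 / Real.sqrt (1 - ‖∇ u x‖ ^ 2)

/-- The graphs of `V t`, `t ∈ ℝ`, are entire spacelike `C²` hypersurfaces that evolve by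
`∂V/∂t = √(1 - |∇V|²) div (∇V / √(1 - |∇V|²))`. -/
structure IsSpacelikeMCF {n : ℕ} (V : ℝ → EuclideanSpace ℝ (Fin n) → ℝ) : Prop where
  contDiff : ∀ t, ContDiff ℝ 2 (V t)
  spacelike : ∀ t x, ‖∇ (V t) x‖ < 1
  equation : ∀ t x, HasDerivAt (fun τ => V τ x)
    (Real.sqrt (1 - ‖∇ (V t) x‖ ^ 2) * euclideanDiv (lorentzField (V t)) x) t

/-- `u` is the initial graph of a spacelike solution `V(x, t) = u(x) + t` of the flow. -/
def IsTranslatingSoliton {n : ℕ} (u : EuclideanSpace ℝ (Fin n) → ℝ) : Prop :=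
  IsSpacelikeMCF (fun t x => u x + t)

/-- `u` is radially symmetric with vertex `x₀`: `u x` depends only on `|x - x₀|`. -/
def IsRadialAbout {n : ℕ} (u : EuclideanSpace ℝ (Fin n) → ℝ)
    (x₀ : EuclideanSpace ℝ (Fin n)) : Prop :=
  ∀ x y, ‖x - x₀‖ = ‖y - x₀‖ → u x = u y

/-- `r ∈ C²[0, ∞)` solves `r'' / (1 - r'²) + (n - 1) r' / t = 1` on `(0, ∞)` with
`r(0) = r'(0) = 0`. Derivatives are taken within `[0, ∞)`, so one-sided at `0`; the field
`nondegenerate` says that the quotient in the equation is defined. -/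
structure IsProfile (n : ℕ) (r : ℝ → ℝ) : Prop where
  contDiffOn : ContDiffOn ℝ 2 r (Ici 0)
  nondegenerate : ∀ t ∈ Ioi (0 : ℝ), 1 - derivWithin r (Ici 0) t ^ 2 ≠ 0
  equation : ∀ t ∈ Ioi (0 : ℝ),
    iteratedDerivWithin 2 r (Ici 0) t / (1 - derivWithin r (Ici 0) t ^ 2)
      + ((n : ℝ) - 1) / t * derivWithin r (Ici 0) t = 1
  init : r 0 = 0
  init_deriv : derivWithin r (Ici 0) 0 = 0

end

/-!
In terms of the momentum `q = r' / √(1 - r'²)` the profile equation reads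
`q' + ((n - 1) / t) q = √(1 + q²)`, whose right-hand side is globally Lipschitz. In the integrated
form `q(t) = t ∫₀¹ σⁿ⁻¹ √(1 + q(tσ)²) dσ` the singularity at `t = 0` is gone, and a contraction in
an exponentially weighted supremum norm yields a solution on all of `ℝ`. It is smooth by
bootstrapping and odd by uniqueness, hence `r` extends to a smooth even function and `r(|x - x₀|)`
is smooth across the vertex. Uniqueness on `[0, ∞)` holds because the singular term
`((n - 1) / t) q` is dissipative. Since `√(1 + q²) ≥ 1`, we have `q ≥ t / n`, which is the lower
bound for `r'`; and `q'` has no first zero, because as long as `q` increases, the mean of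
`√(1 + q²)` is dominated by its final value. Thus `r'' > 0`.
-/

section RadialMean

variable {F : Type*} [NormedAddCommGroup F] [NormedSpace ℝ F]

/-- The weighted mean `∫₀¹ σᵐ b(tσ) dσ`. For `t ≠ 0` it is `t⁻ᵐ⁻¹ ∫₀ᵗ sᵐ b(s) ds`, the operator that
inverts the singular differential operator `t b' + (m + 1) b`; the form chosen here has no
singularity at `t = 0`. -/
noncomputable def radialMean (m : ℕ) (b : ℝ → F) (t : ℝ) : F :=
  ∫ σ in (0 : ℝ)..1, σ ^ m • b (t * σ)

theorem continuous_radialMean (m : ℕ) {b : ℝ → F} (hb : Continuous b) :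
    Continuous (radialMean m b) := by
  apply intervalIntegral.continuous_parametric_intervalIntegral_of_continuous'
  fun_prop

theorem even_radialMean (m : ℕ) {b : ℝ → F} (hb : b.Even) : (radialMean m b).Even := fun t => by
  simp only [radialMean, neg_mul, hb _]

theorem radialMean_const [CompleteSpace F] (m : ℕ) (c : F) (t : ℝ) :
    radialMean m (fun _ => c) t = ((m : ℝ) + 1)⁻¹ • c := by
  simp [radialMean, intervalIntegral.integral_smul_const]

theorem radialMean_zero [CompleteSpace F] (m : ℕ) (b : ℝ → F) :
    radialMean m b 0 = ((m : ℝ) + 1)⁻¹ • b 0 := by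
  rw [← radialMean_const m (b 0) 0]
  simp only [radialMean, zero_mul]

theorem radialMean_sub (m : ℕ) {b c : ℝ → F} (hb : Continuous b) (hc : Continuous c) (t : ℝ) :
    radialMean m (b - c) t = radialMean m b t - radialMean m c t := by
  simp only [radialMean, Pi.sub_apply, smul_sub]
  exact intervalIntegral.integral_sub ((by fun_prop : Continuous _).intervalIntegrable _ _)
    ((by fun_prop : Continuous _).intervalIntegrable _ _)

theorem radialMean_mono {m : ℕ} {b c : ℝ → ℝ} {t : ℝ} (ht : 0 ≤ t) (hb : Continuous b)
    (hc : Continuous c) (h : ∀ s ∈ Icc 0 t, b s ≤ c s) : radialMean m b t ≤ radialMean m c t := by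
  refine intervalIntegral.integral_mono_on zero_le_one
    ((by fun_prop : Continuous _).intervalIntegrable _ _)
    ((by fun_prop : Continuous _).intervalIntegrable _ _) fun σ hσ => ?_
  have hmem : t * σ ∈ Icc 0 t := ⟨mul_nonneg ht hσ.1, mul_le_of_le_one_right ht hσ.2⟩
  exact mul_le_mul_of_nonneg_left (h _ hmem) (pow_nonneg hσ.1 m)

theorem pow_smul_radialMean (m : ℕ) (b : ℝ → F) (t : ℝ) :
    t ^ (m + 1) • radialMean m b t = ∫ s in (0 : ℝ)..t, s ^ m • b s := by
  have h := intervalIntegral.smul_integral_comp_mul_left (a := 0) (b := 1)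
    (fun s => s ^ m • b s) t
  rw [mul_zero, mul_one] at h
  simp only [← h, radialMean, pow_succ', mul_smul, ← intervalIntegral.integral_smul, mul_pow]

theorem hasDerivAt_smul_radialMean [CompleteSpace F] (m : ℕ) {b : ℝ → F} (hb : Continuous b)
    (t : ℝ) :
    HasDerivAt (fun t => t • radialMean m b t) (b t - (m : ℝ) • radialMean m b t) t := by
  rcases eq_or_ne t 0 with rfl | ht
  · have hlim : Tendsto (radialMean m b) (𝓝[≠] 0) (𝓝 (radialMean m b 0)) :=
      (continuous_radialMean m hb).continuousAt.tendsto.mono_left nhdsWithin_le_nhds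
    have hval : b 0 - (m : ℝ) • radialMean m b 0 = radialMean m b 0 := by
      have hm : (m : ℝ) + 1 ≠ 0 := by positivity
      have hb0 : b 0 = ((m : ℝ) + 1) • radialMean m b 0 := by
        rw [radialMean_zero, smul_inv_smul₀ hm]
      rw [hb0, ← sub_smul, add_sub_cancel_left, one_smul]
    rw [hasDerivAt_iff_tendsto_slope_zero, hval]
    refine hlim.congr' ?_
    filter_upwards [self_mem_nhdsWithin] with s hs
    rw [zero_add, zero_smul, sub_zero, inv_smul_smul₀ hs]
  · have hint : HasDerivAt (fun t => ∫ s in (0 : ℝ)..t, s ^ m • b s) (t ^ m • b t) t :=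
      ((by fun_prop : Continuous fun s => s ^ m • b s).integral_hasStrictDerivAt 0 t).hasDerivAt
    have hquot : (fun s => s • radialMean m b s) =ᶠ[𝓝 t]
        fun s => s ^ (-m : ℤ) • ∫ r in (0 : ℝ)..s, r ^ m • b r := by
      filter_upwards [isOpen_ne.mem_nhds ht] with s hs
      rw [← pow_smul_radialMean, pow_succ, mul_smul, zpow_neg, zpow_natCast,
        inv_smul_smul₀ (pow_ne_zero m hs)]
    refine (((hasDerivAt_zpow (-m) t (Or.inl ht)).smul hint).congr_of_eventuallyEq
      hquot).congr_deriv ?_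
    rw [← pow_smul_radialMean, smul_smul, smul_smul, zpow_sub_one₀ ht, zpow_neg, zpow_natCast,
      inv_mul_cancel₀ (pow_ne_zero m ht), one_smul, sub_eq_add_neg, ← neg_smul]
    congr 2
    push_cast
    field_simp
    ring

theorem hasDerivAt_radialMean (m : ℕ) {b : ℝ → F} (hb : ContDiff ℝ 1 b) (t : ℝ) :
    HasDerivAt (radialMean m b) (radialMean (m + 1) (deriv b) t) t := by
  obtain ⟨hd, hd'⟩ := contDiff_one_iff_deriv.1 hb
  have hc : Continuous b := hb.continuous
  obtain ⟨C, hC⟩ := (isCompact_closedBall (0 : ℝ) (|t| + 1)).exists_bound_of_continuousOn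
    hd'.continuousOn
  refine (intervalIntegral.hasDerivAt_integral_of_dominated_loc_of_deriv_le
    (F := fun t σ => σ ^ m • b (t * σ)) (F' := fun t σ => σ ^ (m + 1) • deriv b (t * σ))
    (bound := fun _ => C) (Metric.ball_mem_nhds t one_pos)
    (.of_forall fun x => (by fun_prop : Continuous _).aestronglyMeasurable)
    ((by fun_prop : Continuous _).intervalIntegrable _ _)
    (by fun_prop : Continuous _).aestronglyMeasurable
    (.of_forall fun σ hσ x hx => ?_) intervalIntegrable_const
    (.of_forall fun σ _ x _ => ?_)).2
  · rw [uIoc_of_le zero_le_one] at hσ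
    have hx' : |x| ≤ |t| + 1 := by
      have := abs_sub_abs_le_abs_sub x t
      have : |x - t| < 1 := hx
      linarith
    have hmem : x * σ ∈ Metric.closedBall (0 : ℝ) (|t| + 1) := by
      rw [mem_closedBall_zero_iff, norm_mul, Real.norm_eq_abs, Real.norm_of_nonneg hσ.1.le]
      exact (mul_le_of_le_one_right (abs_nonneg x) hσ.2).trans hx'
    rw [norm_smul, norm_pow, Real.norm_of_nonneg hσ.1.le]
    exact (mul_le_of_le_one_left (norm_nonneg _) (pow_le_one₀ hσ.1.le hσ.2)).trans (hC _ hmem)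
  · have hscale : HasDerivAt (fun x => x * σ) σ x := by
      simpa using (hasDerivAt_id x).mul_const σ
    have h := ((hd (x * σ)).hasDerivAt.scomp x hscale).const_smul (σ ^ m)
    rw [smul_smul, ← pow_succ] at h
    exact h

theorem contDiff_radialMean (m : ℕ) {k : ℕ} {b : ℝ → F} (hb : ContDiff ℝ k b) :
    ContDiff ℝ k (radialMean m b) := by
  induction k generalizing m b with
  | zero => exact contDiff_zero.2 (continuous_radialMean m hb.continuous)
  | succ k ih =>
    have hderiv := hasDerivAt_radialMean m (hb.of_le (by norm_cast; omega))
    push_cast at hb ⊢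
    rw [contDiff_succ_iff_deriv, funext fun t => (hderiv t).deriv]
    exact ⟨fun t => (hderiv t).differentiableAt, by simp,
      ih (m + 1) (contDiff_succ_iff_deriv.1 hb).2.2⟩

theorem contDiff_infty_radialMean (m : ℕ) {b : ℝ → F} (hb : ContDiff ℝ ∞ b) :
    ContDiff ℝ ∞ (radialMean m b) :=
  contDiff_infty.2 fun k => contDiff_radialMean m (contDiff_infty.1 hb k)

theorem contDiff_smul_radialMean [CompleteSpace F] (m : ℕ) {k : ℕ} {b : ℝ → F}
    (hb : ContDiff ℝ k b) : ContDiff ℝ (k + 1) (fun t => t • radialMean m b t) := by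
  have hderiv := hasDerivAt_smul_radialMean m hb.continuous
  rw [contDiff_succ_iff_deriv, funext fun t => (hderiv t).deriv]
  exact ⟨fun t => (hderiv t).differentiableAt, by simp,
    hb.sub (contDiff_const.smul (contDiff_radialMean m hb))⟩

/-- On functions of size `O(exp (l|t|))`, integration gains a factor `1 / l`, so that a large `l`
makes the Picard operator a contraction. -/
theorem norm_smul_radialMean_le (m : ℕ) {b : ℝ → F} {C l : ℝ} (hl : 0 < l)
    (hb : ∀ s, ‖b s‖ ≤ C * Real.exp (l * |s|)) (t : ℝ) :
    ‖t • radialMean m b t‖ ≤ C / l * Real.exp (l * |t|) := by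
  have hC : 0 ≤ C := by simpa using (norm_nonneg _).trans (hb 0)
  have hint : ∫ σ in (0 : ℝ)..1, |t| * Real.exp (l * |t| * σ) =
      (Real.exp (l * |t|) - 1) / l := by
    have hderiv : ∀ σ ∈ uIcc (0 : ℝ) 1, HasDerivAt (fun σ => Real.exp (l * |t| * σ) / l)
        (|t| * Real.exp (l * |t| * σ)) σ := fun σ _ => by
      refine ((((hasDerivAt_id σ).const_mul (l * |t|)).exp).div_const l).congr_deriv ?_
      simp only [id, mul_one]
      field_simp
    rw [intervalIntegral.integral_eq_sub_of_hasDerivAt hderiv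
      ((by fun_prop : Continuous _).intervalIntegrable _ _), mul_one, mul_zero, Real.exp_zero,
      sub_div]
  rw [radialMean, ← intervalIntegral.integral_smul]
  calc ‖∫ σ in (0 : ℝ)..1, t • σ ^ m • b (t * σ)‖
      ≤ ∫ σ in (0 : ℝ)..1, C * (|t| * Real.exp (l * |t| * σ)) := by
        refine intervalIntegral.norm_integral_le_of_norm_le zero_le_one
          (.of_forall fun σ hσ => ?_) ((by fun_prop : Continuous _).intervalIntegrable _ _)
        rw [norm_smul, norm_smul, norm_pow, Real.norm_of_nonneg hσ.1.le, Real.norm_eq_abs]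
        calc |t| * (σ ^ m * ‖b (t * σ)‖) ≤ |t| * (1 * (C * Real.exp (l * |t * σ|))) := by
              gcongr
              · exact pow_le_one₀ hσ.1.le hσ.2
              · exact hb _
          _ = C * (|t| * Real.exp (l * |t| * σ)) := by
              rw [abs_mul, abs_of_pos hσ.1]
              ring_nf
    _ = C * ((Real.exp (l * |t|) - 1) / l) := by rw [intervalIntegral.integral_const_mul, hint]
    _ ≤ C * (Real.exp (l * |t|) / l) := by gcongr; linarith
    _ = C / l * Real.exp (l * |t|) := by ring

end RadialMean

section MildSolution

open scoped BoundedContinuousFunction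

variable {F : Type*} [NormedAddCommGroup F] [NormedSpace ℝ F] {m : ℕ} {f : F → F} {q : ℝ → F}

/-- `q` solves the singular initial value problem `q' + (m / t) q = f(q)`, `q(0) = 0`, in the
integrated form `tᵐ q(t) = ∫₀ᵗ sᵐ f(q(s)) ds`. The solution lives on all of `ℝ`, so that smoothness
at `t = 0` is not a one-sided notion. -/
structure IsMildSolution (m : ℕ) (f : F → F) (q : ℝ → F) : Prop where
  continuous : Continuous q
  eq_smul_radialMean : ∀ t, q t = t • radialMean m (f ∘ q) t

theorem norm_exp_smul_le_of_lipschitzWith {K : NNReal} (hf : LipschitzWith K f) {l B : ℝ}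
    (hl : 0 ≤ l) {x : F} (hx : ‖x‖ ≤ B) (s : ℝ) :
    ‖f (Real.exp (l * |s|) • x)‖ ≤ (‖f 0‖ + K * B) * Real.exp (l * |s|) := by
  have hexp : 1 ≤ Real.exp (l * |s|) := Real.one_le_exp (by positivity)
  have hlip : ‖f (Real.exp (l * |s|) • x) - f 0‖ ≤ K * (Real.exp (l * |s|) * ‖x‖) := by
    simpa only [sub_zero, norm_smul, Real.norm_of_nonneg (Real.exp_pos _).le] using
      hf.norm_sub_le (Real.exp (l * |s|) • x) 0
  calc ‖f (Real.exp (l * |s|) • x)‖ ≤ ‖f 0‖ + ‖f (Real.exp (l * |s|) • x) - f 0‖ :=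
        norm_le_insert' _ _
    _ ≤ ‖f 0‖ * Real.exp (l * |s|) + K * (Real.exp (l * |s|) * B) := by
        refine add_le_add (le_mul_of_one_le_right (norm_nonneg _) hexp) (hlip.trans ?_)
        gcongr
    _ = (‖f 0‖ + K * B) * Real.exp (l * |s|) := by ring

/-- The Picard operator of `q' + (m / t) q = f(q)` for `b = exp(-(K + 1)|t|) q`, where `K` is a
Lipschitz constant of `f`. -/
noncomputable def weightedPicard (m : ℕ) {K : NNReal} (hf : LipschitzWith K f)
    (b : ℝ →ᵇ F) : ℝ →ᵇ F :=
  have hcont : Continuous fun s => f (Real.exp ((K + 1) * |s|) • b s) :=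
    hf.continuous.comp (by fun_prop)
  have hmean := continuous_radialMean m hcont
  .ofNormedAddCommGroup
    (fun t => Real.exp (-((K + 1) * |t|)) •
      t • radialMean m (fun s => f (Real.exp ((K + 1) * |s|) • b s)) t)
    (by fun_prop) ((‖f 0‖ + K * ‖b‖) / (K + 1)) fun t => by
      rw [norm_smul, Real.norm_of_nonneg (Real.exp_pos _).le, Real.exp_neg,
        inv_mul_le_iff₀ (Real.exp_pos _), mul_comm]
      exact norm_smul_radialMean_le m (by positivity)
        (fun s => norm_exp_smul_le_of_lipschitzWith hf (by positivity) (b.norm_coe_le_norm s) s) t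

theorem weightedPicard_apply (m : ℕ) {K : NNReal} (hf : LipschitzWith K f) (b : ℝ →ᵇ F) (t : ℝ) :
    weightedPicard m hf b t = Real.exp (-((K + 1) * |t|)) •
      t • radialMean m (fun s => f (Real.exp ((K + 1) * |s|) • b s)) t :=
  rfl

theorem contractingWith_weightedPicard (m : ℕ) {K : NNReal} (hf : LipschitzWith K f) :
    ContractingWith (K / (K + 1)) (weightedPicard m hf) := by
  refine ⟨by rw [div_lt_one (by positivity)]; exact lt_add_one K,
    LipschitzWith.of_dist_le_mul fun b c => ?_⟩
  have hcont : ∀ b : ℝ →ᵇ F,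
      Continuous fun s => f (Real.exp ((K + 1) * |s|) • b s) :=
    fun b => hf.continuous.comp (by fun_prop)
  refine (BoundedContinuousFunction.dist_le (by positivity)).2 fun t => ?_
  have hgrowth : ∀ s, ‖((fun s => f (Real.exp ((K + 1) * |s|) • b s)) -
      fun s => f (Real.exp ((K + 1) * |s|) • c s)) s‖ ≤
        K * dist b c * Real.exp ((K + 1) * |s|) := fun s => by
    calc ‖f (Real.exp ((K + 1) * |s|) • b s) - f (Real.exp ((K + 1) * |s|) • c s)‖
        ≤ K * ‖Real.exp ((K + 1) * |s|) • b s - Real.exp ((K + 1) * |s|) • c s‖ :=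
          hf.norm_sub_le _ _
      _ ≤ K * (Real.exp ((K + 1) * |s|) * dist b c) := by
          rw [← smul_sub, norm_smul, Real.norm_of_nonneg (Real.exp_pos _).le, ← dist_eq_norm]
          gcongr
          exact BoundedContinuousFunction.dist_coe_le_dist s
      _ = K * dist b c * Real.exp ((K + 1) * |s|) := by ring
  have hmean := norm_smul_radialMean_le m (by positivity) hgrowth t
  rw [radialMean_sub m (hcont b) (hcont c), smul_sub] at hmean
  rw [weightedPicard_apply, weightedPicard_apply, dist_eq_norm, ← smul_sub, norm_smul,
    Real.norm_of_nonneg (Real.exp_pos _).le, Real.exp_neg, inv_mul_le_iff₀ (Real.exp_pos _),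
    mul_comm]
  refine hmean.trans_eq ?_
  push_cast
  ring

theorem exists_isMildSolution [CompleteSpace F] (m : ℕ) {K : NNReal} (hf : LipschitzWith K f) :
    ∃ q, IsMildSolution m f q := by
  have hcontr := contractingWith_weightedPicard m hf
  have hfix := hcontr.fixedPoint_isFixedPt
  set b := hcontr.fixedPoint
  refine ⟨fun t => Real.exp ((K + 1) * |t|) • b t, by fun_prop, fun t => ?_⟩
  have hb : b t = weightedPicard m hf b t := (DFunLike.congr_fun hfix t).symm
  rw [hb, weightedPicard_apply, Real.exp_neg, smul_inv_smul₀ (Real.exp_pos _).ne']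
  rfl

/-- The one-sided Lipschitz bound makes `exp(-2Kt) ‖q₁ - q₂‖²` antitone. -/
theorem eqOn_Ici_of_inner_le {F : Type*} [NormedAddCommGroup F] [InnerProductSpace ℝ F]
    {v : ℝ → F → F} {K : ℝ}
    (hv : ∀ t > 0, ∀ x y, inner ℝ (v t x - v t y) (x - y) ≤ K * ‖x - y‖ ^ 2) {q₁ q₂ : ℝ → F}
    (hc₁ : ContinuousOn q₁ (Ici 0)) (hc₂ : ContinuousOn q₂ (Ici 0))
    (hd₁ : ∀ t > 0, HasDerivAt q₁ (v t (q₁ t)) t) (hd₂ : ∀ t > 0, HasDerivAt q₂ (v t (q₂ t)) t)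
    (h0 : q₁ 0 = q₂ 0) : EqOn q₁ q₂ (Ici 0) := by
  let E : ℝ → ℝ := fun t => Real.exp (-(2 * K) * t) * ‖q₁ t - q₂ t‖ ^ 2
  have hE : ∀ t > 0, HasDerivAt E (Real.exp (-(2 * K) * t) *
      (2 * inner ℝ (v t (q₁ t) - v t (q₂ t)) (q₁ t - q₂ t) -
        2 * K * ‖q₁ t - q₂ t‖ ^ 2)) t := fun t ht => by
    refine (((hasDerivAt_id t).const_mul (-(2 * K))).exp.mul
      ((hd₁ t ht).sub (hd₂ t ht)).norm_sq).congr_deriv ?_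
    rw [real_inner_comm]
    simp only [id, mul_one, Pi.sub_apply]
    ring
  have hanti : AntitoneOn E (Ici 0) := by
    refine antitoneOn_of_deriv_nonpos (convex_Ici 0) (by fun_prop) ?_ ?_ <;> rw [interior_Ici]
    · exact fun t ht => (hE t ht).differentiableAt.differentiableWithinAt
    · intro t ht
      rw [(hE t ht).deriv]
      exact mul_nonpos_of_nonneg_of_nonpos (Real.exp_pos _).le
        (by linarith [hv t ht (q₁ t) (q₂ t)])
  intro t ht
  have hle : E t ≤ 0 := (hanti self_mem_Ici ht ht).trans_eq (by simp [E, h0])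
  have hsq : ‖q₁ t - q₂ t‖ ^ 2 ≤ 0 := nonpos_of_mul_nonpos_right hle (Real.exp_pos _)
  exact sub_eq_zero.1 (norm_eq_zero.1 (pow_eq_zero_iff two_ne_zero |>.1
    (hsq.antisymm (sq_nonneg _))))

theorem inner_sub_smul_sub_le {F : Type*} [NormedAddCommGroup F] [InnerProductSpace ℝ F]
    {f : F → F} {K : NNReal} (hf : LipschitzWith K f) {c : ℝ} (hc : 0 ≤ c) (x y : F) :
    inner ℝ (f x - c • x - (f y - c • y)) (x - y) ≤ K * ‖x - y‖ ^ 2 := by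
  have hlip : inner ℝ (f x - f y) (x - y) ≤ K * ‖x - y‖ ^ 2 :=
    calc inner ℝ (f x - f y) (x - y) ≤ ‖f x - f y‖ * ‖x - y‖ := real_inner_le_norm _ _
      _ ≤ K * ‖x - y‖ * ‖x - y‖ := by gcongr; exact hf.norm_sub_le x y
      _ = K * ‖x - y‖ ^ 2 := by ring
  have hsplit : f x - c • x - (f y - c • y) = f x - f y - c • (x - y) := by
    rw [smul_sub]; abel
  rw [hsplit, inner_sub_left, real_inner_smul_left, real_inner_self_eq_norm_sq]
  linarith [mul_nonneg hc (sq_nonneg ‖x - y‖)]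

namespace IsMildSolution

theorem map_zero (h : IsMildSolution m f q) : q 0 = 0 := by
  rw [h.eq_smul_radialMean, zero_smul]

theorem hasDerivAt [CompleteSpace F] (h : IsMildSolution m f q) (hf : Continuous f) (t : ℝ) :
    HasDerivAt q (f (q t) - (m : ℝ) • radialMean m (f ∘ q) t) t :=
  (hasDerivAt_smul_radialMean m (hf.comp h.continuous) t).congr_of_eventuallyEq
    (.of_forall h.eq_smul_radialMean)

theorem hasDerivAt_of_ne_zero [CompleteSpace F] (h : IsMildSolution m f q) (hf : Continuous f)
    {t : ℝ} (ht : t ≠ 0) : HasDerivAt q (f (q t) - ((m : ℝ) / t) • q t) t := by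
  refine (h.hasDerivAt hf t).congr_deriv ?_
  nth_rw 3 [h.eq_smul_radialMean t]
  rw [smul_smul, div_mul_cancel₀ _ ht]

theorem contDiff [CompleteSpace F] (h : IsMildSolution m f q) (hf : ContDiff ℝ ∞ f) :
    ContDiff ℝ ∞ q := by
  refine contDiff_infty.2 fun k => ?_
  induction k with
  | zero => exact contDiff_zero.2 h.continuous
  | succ k ih =>
    rw [funext h.eq_smul_radialMean]
    exact contDiff_smul_radialMean m ((contDiff_infty.1 hf k).comp ih)

theorem odd {F : Type*} [NormedAddCommGroup F] [InnerProductSpace ℝ F] [CompleteSpace F]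
    {f : F → F} {q : ℝ → F} {K : NNReal} (h : IsMildSolution m f q) (hf : LipschitzWith K f)
    (he : f.Even) : q.Odd := by
  have hreflect : ∀ t > 0, HasDerivAt (fun t => -q (-t))
      (f (-q (-t)) - ((m : ℝ) / t) • -q (-t)) t := fun t ht => by
    have hneg := (h.hasDerivAt_of_ne_zero hf.continuous (neg_ne_zero.2 ht.ne')).scomp t
      (hasDerivAt_neg t)
    refine hneg.neg.congr_deriv ?_
    rw [he, div_neg, neg_smul, neg_smul, one_smul, neg_neg, smul_neg]
  have hEq : EqOn (fun t => -q (-t)) q (Ici 0) :=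
    eqOn_Ici_of_inner_le (v := fun t x => f x - ((m : ℝ) / t) • x)
      (fun t ht => inner_sub_smul_sub_le hf (by positivity))
      (h.continuous.comp continuous_neg).neg.continuousOn h.continuous.continuousOn hreflect
      (fun t ht => h.hasDerivAt_of_ne_zero hf.continuous ht.ne') (by simp [h.map_zero])
  intro t
  rcases le_total 0 t with ht | ht
  · exact neg_eq_iff_eq_neg.1 (hEq ht)
  · simpa using (hEq (neg_nonneg.2 ht)).symm

end IsMildSolution

end MildSolution

section Monotone

theorem forall_pos_of_forall_Ico_pos {g : ℝ → ℝ} (hg : Continuous g)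
    (h : ∀ t ≥ 0, (∀ s ∈ Ico 0 t, 0 < g s) → 0 < g t) {t : ℝ} (ht : 0 ≤ t) : 0 < g t := by
  by_contra! hneg
  have hclosed : IsClosed (Ici 0 ∩ {s | g s ≤ 0}) :=
    isClosed_Ici.inter (isClosed_le hg continuous_const)
  obtain ⟨⟨hfirst, hle⟩, hleast⟩ :=
    hclosed.isLeast_csInf ⟨t, ht, hneg⟩ ⟨0, fun s hs => hs.1⟩
  refine hle.not_gt (h _ hfirst fun s hs => ?_)
  by_contra! hs'
  exact hs.2.not_ge (hleast ⟨hs.1, hs'⟩)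

variable {m : ℕ} {f q : ℝ → ℝ}

/-- Up to the first zero of `q'` the integrand `f ∘ q` is monotone, so its mean is at most
`f(q(t)) / (m + 1)` and `q'(t) ≥ f(q(t)) / (m + 1) > 0`. -/
theorem IsMildSolution.deriv_pos (h : IsMildSolution m f q) (hf : Continuous f)
    (hmono : MonotoneOn f (Ici 0)) (h0 : 0 < f 0) {t : ℝ} (ht : 0 ≤ t) : 0 < deriv q t := by
  have hfq : Continuous (f ∘ q) := hf.comp h.continuous
  have hderiv : ∀ t, deriv q t = f (q t) - m * radialMean m (f ∘ q) t := fun t =>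
    (h.hasDerivAt hf t).deriv
  have hcont : Continuous (deriv q) := by
    rw [funext hderiv]
    exact hfq.sub (continuous_const.mul (continuous_radialMean m hfq))
  refine forall_pos_of_forall_Ico_pos hcont (fun t ht hpos => ?_) ht
  have hqmono : MonotoneOn q (Icc 0 t) := by
    refine monotoneOn_of_deriv_nonneg (convex_Icc 0 t) h.continuous.continuousOn
      (fun s _ => (h.hasDerivAt hf s).differentiableAt.differentiableWithinAt) fun s hs => ?_
    rw [interior_Icc] at hs
    exact (hpos s (Ioo_subset_Ico_self hs)).le
  have hq0 : ∀ s ∈ Icc 0 t, 0 ≤ q s := fun s hs =>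
    h.map_zero.ge.trans (hqmono (left_mem_Icc.2 ht) hs hs.1)
  have hmean : radialMean m (f ∘ q) t ≤ (m + 1 : ℝ)⁻¹ * f (q t) := by
    refine (radialMean_mono ht hfq continuous_const fun s hs => ?_).trans_eq
      (radialMean_const m (f (q t)) t)
    exact hmono (hq0 s hs) (hq0 t (right_mem_Icc.2 ht))
      (hqmono hs (right_mem_Icc.2 ht) hs.2)
  have hfpos : 0 < f (q t) :=
    h0.trans_le (hmono self_mem_Ici (hq0 t (right_mem_Icc.2 ht)) (hq0 t (right_mem_Icc.2 ht)))
  have hm : (m + 1 : ℝ) ≠ 0 := by positivity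
  calc 0 < (m + 1 : ℝ)⁻¹ * f (q t) := by positivity
    _ = f (q t) - m * ((m + 1 : ℝ)⁻¹ * f (q t)) := by field_simp; ring
    _ ≤ f (q t) - m * radialMean m (f ∘ q) t := by gcongr
    _ = deriv q t := (hderiv t).symm

end Monotone

section Momentum

/-- The Lorentz factor `γ = √(1 + q²) = 1 / √(1 - p²)` in terms of the momentum `q = p / √(1 - p²)`
belonging to the velocity `p`. -/
noncomputable def lorentzFactor (q : ℝ) : ℝ := √(1 + q ^ 2)

/-- The velocity `p = q / √(1 + q²)` with momentum `q`. -/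
noncomputable def velocity (q : ℝ) : ℝ := q / lorentzFactor q

/-- The momentum `q = p / √(1 - p²)` of the velocity `p`; meaningful for `|p| < 1` only. -/
noncomputable def momentum (p : ℝ) : ℝ := p / √(1 - p ^ 2)

theorem lorentzFactor_sq (q : ℝ) : lorentzFactor q ^ 2 = 1 + q ^ 2 :=
  Real.sq_sqrt (by positivity)

theorem lorentzFactor_pos (q : ℝ) : 0 < lorentzFactor q := Real.sqrt_pos.2 (by positivity)

theorem one_le_lorentzFactor (q : ℝ) : 1 ≤ lorentzFactor q :=
  Real.one_le_sqrt.2 (le_add_of_nonneg_right (sq_nonneg q))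

theorem contDiff_lorentzFactor : ContDiff ℝ ∞ lorentzFactor :=
  ContDiff.sqrt (by fun_prop) fun q => by positivity

theorem even_lorentzFactor : lorentzFactor.Even := fun q => by rw [lorentzFactor, neg_sq]; rfl

theorem monotoneOn_lorentzFactor : MonotoneOn lorentzFactor (Ici 0) := fun q hq r _ hqr =>
  Real.sqrt_le_sqrt (by have : (0 : ℝ) ≤ q := hq; gcongr)

/-- `√(1 + q²)` is the norm of `1 + q i`. -/
theorem lipschitzWith_lorentzFactor : LipschitzWith 1 lorentzFactor := by
  have hnorm : ∀ q : ℝ, lorentzFactor q = ‖1 + (q : ℂ) * Complex.I‖ := fun q => by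
    simpa [lorentzFactor] using (Complex.norm_add_mul_I 1 q).symm
  refine LipschitzWith.mk_one fun q r => ?_
  rw [hnorm, hnorm]
  calc |‖1 + (q : ℂ) * Complex.I‖ - ‖1 + (r : ℂ) * Complex.I‖|
      ≤ ‖1 + (q : ℂ) * Complex.I - (1 + r * Complex.I)‖ := abs_norm_sub_norm_le _ _
    _ = |q - r| := by
      rw [add_sub_add_left_eq_sub, ← sub_mul, norm_mul, Complex.norm_I, mul_one,
        ← Complex.ofReal_sub, Complex.norm_real, Real.norm_eq_abs]

theorem one_sub_velocity_sq (q : ℝ) : 1 - velocity q ^ 2 = (lorentzFactor q ^ 2)⁻¹ := by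
  have hγ := lorentzFactor_sq q
  have hγ0 := (lorentzFactor_pos q).ne'
  rw [velocity, div_pow]
  field_simp
  linarith

theorem sqrt_one_sub_velocity_sq (q : ℝ) : √(1 - velocity q ^ 2) = (lorentzFactor q)⁻¹ := by
  rw [one_sub_velocity_sq, ← inv_pow, Real.sqrt_sq (inv_nonneg.2 (lorentzFactor_pos q).le)]

theorem velocity_sq_lt_one (q : ℝ) : velocity q ^ 2 < 1 := by
  have h : 0 < 1 - velocity q ^ 2 := by
    rw [one_sub_velocity_sq]
    exact inv_pos.2 (pow_pos (lorentzFactor_pos q) 2)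
  linarith

theorem momentum_velocity (q : ℝ) : momentum (velocity q) = q := by
  rw [momentum, sqrt_one_sub_velocity_sq, div_inv_eq_mul, velocity,
    div_mul_cancel₀ _ (lorentzFactor_pos q).ne']

theorem lorentzFactor_momentum {p : ℝ} (hp : p ^ 2 < 1) :
    lorentzFactor (momentum p) = (√(1 - p ^ 2))⁻¹ := by
  have h : 0 < 1 - p ^ 2 := sub_pos.2 hp
  rw [lorentzFactor, momentum, div_pow, Real.sq_sqrt h.le, ← Real.sqrt_inv]
  congr 1
  field_simp
  ring

theorem velocity_momentum {p : ℝ} (hp : p ^ 2 < 1) : velocity (momentum p) = p := by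
  rw [velocity, lorentzFactor_momentum hp, momentum, div_inv_eq_mul,
    div_mul_cancel₀ _ (Real.sqrt_pos.2 (sub_pos.2 hp)).ne']

theorem hasDerivAt_velocity (q : ℝ) : HasDerivAt velocity ((lorentzFactor q ^ 3)⁻¹) q := by
  have hγ := lorentzFactor_sq q
  have hγ0 := (lorentzFactor_pos q).ne'
  have hderiv : HasDerivAt lorentzFactor (q / lorentzFactor q) q := by
    refine ((hasDerivAt_pow 2 q).const_add 1).sqrt (by positivity) |>.congr_deriv ?_
    rw [← lorentzFactor]
    field_simp
    norm_num
  refine ((hasDerivAt_id q).div hderiv hγ0).congr_deriv ?_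
  simp only [id]
  field_simp
  linarith

theorem strictMono_velocity : StrictMono velocity :=
  strictMono_of_deriv_pos fun q => by
    rw [(hasDerivAt_velocity q).deriv]
    exact inv_pos.2 (pow_pos (lorentzFactor_pos q) 3)

theorem hasDerivAt_momentum {p : ℝ} (hp : p ^ 2 < 1) :
    HasDerivAt momentum ((√(1 - p ^ 2) ^ 3)⁻¹) p := by
  have h : 0 < 1 - p ^ 2 := sub_pos.2 hp
  have hS := (Real.sqrt_pos.2 h).ne'
  have hS2 : √(1 - p ^ 2) ^ 2 = 1 - p ^ 2 := Real.sq_sqrt h.le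
  refine ((hasDerivAt_id p).div (((hasDerivAt_pow 2 p).const_sub 1).sqrt h.ne') hS).congr_deriv ?_
  simp only [id]
  field_simp
  rw [hS2]
  push_cast
  ring

theorem contDiff_velocity : ContDiff ℝ ∞ velocity :=
  contDiff_id.div contDiff_lorentzFactor fun q => (lorentzFactor_pos q).ne'

theorem odd_velocity : velocity.Odd := fun q => by
  rw [velocity, even_lorentzFactor, neg_div]; rfl

/-- Multiplication by `γ = 1 / √(1 - p²)`: with `p' = dp` and `q = momentum p` the left-hand side is
the profile equation for `p = r'`, and the right-hand side reads `q' = γ - c q`. -/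
theorem div_one_sub_sq_add_eq_one_iff {p : ℝ} (hp : p ^ 2 < 1) (dp c : ℝ) :
    dp / (1 - p ^ 2) + c * p = 1 ↔
      (√(1 - p ^ 2) ^ 3)⁻¹ * dp = lorentzFactor (momentum p) - c * momentum p := by
  have h : 0 < 1 - p ^ 2 := sub_pos.2 hp
  have hS := (Real.sqrt_pos.2 h).ne'
  have hS2 : √(1 - p ^ 2) ^ 2 = 1 - p ^ 2 := Real.sq_sqrt h.le
  rw [lorentzFactor_momentum hp, momentum]
  set S := √(1 - p ^ 2)
  rw [← hS2]
  field_simp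
  constructor <;> intro heq <;> linarith

end Momentum

theorem derivWithin_Ici_eq_deriv {g : ℝ → ℝ} (hg : Differentiable ℝ g) {t : ℝ} (ht : 0 ≤ t) :
    derivWithin g (Ici 0) t = deriv g t :=
  (hg t).derivWithin (uniqueDiffOn_Ici 0 t ht)

theorem iteratedDerivWithin_two_Ici_eq_deriv {g : ℝ → ℝ} (hg : ContDiff ℝ 2 g) {t : ℝ}
    (ht : 0 ≤ t) : iteratedDerivWithin 2 g (Ici 0) t = deriv (deriv g) t := by
  rw [iteratedDerivWithin_eq_iteratedDeriv (uniqueDiffOn_Ici 0) hg.contDiffAt ht,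
    iteratedDeriv_succ, iteratedDeriv_one]

namespace IsProfile

variable {n : ℕ} {r s : ℝ → ℝ}

theorem continuousOn_derivWithin (h : IsProfile n r) :
    ContinuousOn (derivWithin r (Ici 0)) (Ici 0) :=
  h.contDiffOn.continuousOn_derivWithin (uniqueDiffOn_Ici 0) (by norm_num)

theorem hasDerivAt_derivWithin (h : IsProfile n r) {t : ℝ} (ht : 0 < t) :
    HasDerivAt (derivWithin r (Ici 0)) (iteratedDerivWithin 2 r (Ici 0) t) t := by
  have hC1 : ContDiffOn ℝ 1 (derivWithin r (Ici 0)) (Ici 0) :=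
    h.contDiffOn.derivWithin (uniqueDiffOn_Ici 0) (by norm_num)
  rw [iteratedDerivWithin_succ, iteratedDerivWithin_one]
  exact (hC1.differentiableOn_one t ht.le).hasDerivWithinAt.hasDerivAt (Ici_mem_nhds ht)

/-- `r'²` starts at `0` and cannot cross the value `1`, where the equation degenerates. -/
theorem derivWithin_sq_lt_one (h : IsProfile n r) {t : ℝ} (ht : 0 ≤ t) :
    derivWithin r (Ici 0) t ^ 2 < 1 := by
  by_contra! hge
  obtain ⟨s, hs, hs1⟩ := intermediate_value_Icc ht
    ((h.continuousOn_derivWithin.pow 2).mono Icc_subset_Ici_self)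
    (⟨by simp [h.init_deriv], hge⟩ : (1 : ℝ) ∈ Icc _ _)
  rcases hs.1.eq_or_lt with rfl | hs0
  · simp [h.init_deriv] at hs1
  · exact h.nondegenerate s hs0 (sub_eq_zero.2 hs1.symm)

theorem continuousOn_momentum_derivWithin (h : IsProfile n r) :
    ContinuousOn (momentum ∘ derivWithin r (Ici 0)) (Ici 0) := fun t ht =>
  (hasDerivAt_momentum (h.derivWithin_sq_lt_one ht)).continuousAt.comp_continuousWithinAt
    (h.continuousOn_derivWithin t ht)

theorem hasDerivAt_momentum_derivWithin (h : IsProfile n r) {t : ℝ} (ht : 0 < t) :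
    HasDerivAt (momentum ∘ derivWithin r (Ici 0))
      (lorentzFactor (momentum (derivWithin r (Ici 0) t)) -
        ((n : ℝ) - 1) / t * momentum (derivWithin r (Ici 0) t)) t := by
  have hlt := h.derivWithin_sq_lt_one ht.le
  exact ((hasDerivAt_momentum hlt).comp t (h.hasDerivAt_derivWithin ht)).congr_deriv
    ((div_one_sub_sq_add_eq_one_iff hlt _ _).1 (h.equation t ht))

theorem of_contDiff (hr : ContDiff ℝ 2 r) (h0 : r 0 = 0) (h0' : deriv r 0 = 0)
    (hlt : ∀ t > 0, deriv r t ^ 2 < 1)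
    (hmom : ∀ t > 0, HasDerivAt (momentum ∘ deriv r)
      (lorentzFactor (momentum (deriv r t)) - ((n : ℝ) - 1) / t * momentum (deriv r t)) t) :
    IsProfile n r where
  contDiffOn := hr.contDiffOn
  nondegenerate t ht := by
    rw [derivWithin_Ici_eq_deriv (hr.differentiable two_ne_zero) (le_of_lt ht)]
    exact (sub_pos.2 (hlt t ht)).ne'
  equation t ht := by
    rw [derivWithin_Ici_eq_deriv (hr.differentiable two_ne_zero) (le_of_lt ht),
      iteratedDerivWithin_two_Ici_eq_deriv hr (le_of_lt ht),
      div_one_sub_sq_add_eq_one_iff (hlt t ht)]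
    have hd : HasDerivAt (deriv r) (deriv (deriv r) t) t :=
      (hr.differentiable_deriv_two t).hasDerivAt
    exact ((hasDerivAt_momentum (hlt t ht)).comp t hd).unique (hmom t ht)
  init := h0
  init_deriv := by rw [derivWithin_Ici_eq_deriv (hr.differentiable two_ne_zero) le_rfl, h0']

theorem eqOn_derivWithin (hn : 1 ≤ n) (hr : IsProfile n r) (hs : IsProfile n s) :
    EqOn (derivWithin r (Ici 0)) (derivWithin s (Ici 0)) (Ici 0) := by
  have hn' : (0 : ℝ) ≤ n - 1 := sub_nonneg.2 (by exact_mod_cast hn)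
  have hmom : EqOn (momentum ∘ derivWithin r (Ici 0)) (momentum ∘ derivWithin s (Ici 0)) (Ici 0) :=
    eqOn_Ici_of_inner_le (v := fun t q => lorentzFactor q - (((n : ℝ) - 1) / t) • q)
      (fun t ht => inner_sub_smul_sub_le lipschitzWith_lorentzFactor (div_nonneg hn' ht.le))
      hr.continuousOn_momentum_derivWithin hs.continuousOn_momentum_derivWithin
      (fun t ht => hr.hasDerivAt_momentum_derivWithin ht)
      (fun t ht => hs.hasDerivAt_momentum_derivWithin ht)
      (by simp only [Function.comp_apply, hr.init_deriv, hs.init_deriv])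
  intro t ht
  rw [← velocity_momentum (hr.derivWithin_sq_lt_one ht),
    ← velocity_momentum (hs.derivWithin_sq_lt_one ht)]
  exact congrArg velocity (hmom ht)

theorem eqOn (hn : 1 ≤ n) (hr : IsProfile n r) (hs : IsProfile n s) : EqOn r s (Ici 0) := by
  refine (convex_Ici (0 : ℝ)).eqOn_of_fderivWithin_eq (𝕜 := ℝ)
    (hr.contDiffOn.differentiableOn two_ne_zero) (hs.contDiffOn.differentiableOn two_ne_zero)
    (uniqueDiffOn_Ici 0) (fun t ht => ?_) self_mem_Ici (hr.init.trans hs.init.symm)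
  ext
  exact hr.eqOn_derivWithin hn hs ht

end IsProfile

section EvenFunction

theorem even_deriv {F : Type*} [NormedAddCommGroup F] [NormedSpace ℝ F] {g : ℝ → F}
    (hg : g.Odd) : (deriv g).Even := fun t => by
  have h := deriv_comp_neg g t
  rw [funext hg, deriv.fun_neg] at h
  exact (neg_injective h).symm

theorem odd_deriv {F : Type*} [NormedAddCommGroup F] [NormedSpace ℝ F] {g : ℝ → F}
    (hg : g.Even) : (deriv g).Odd := fun t => by
  have h := deriv_comp_neg g t
  rw [funext hg] at h
  exact neg_eq_iff_eq_neg.1 h.symm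

theorem exists_hasDerivAt_mul_of_even {g : ℝ → ℝ} (hg : ContDiff ℝ ∞ g) (he : g.Even) :
    ∃ h : ℝ → ℝ, ContDiff ℝ ∞ h ∧ h.Even ∧ ∀ t, HasDerivAt g (t * h t) t := by
  have hd : ContDiff ℝ ∞ (deriv g) := (contDiff_infty_iff_deriv.1 hg).2
  have hd' : ContDiff ℝ ∞ (deriv (deriv g)) := (contDiff_infty_iff_deriv.1 hd).2
  refine ⟨radialMean 0 (deriv (deriv g)), contDiff_infty_radialMean 0 hd',
    even_radialMean 0 (even_deriv (odd_deriv he)), fun t => ?_⟩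
  have hFTC : t * radialMean 0 (deriv (deriv g)) t = deriv g t := by
    have h := pow_smul_radialMean 0 (deriv (deriv g)) t
    simp only [zero_add, pow_one, pow_zero, one_mul, smul_eq_mul] at h
    rw [h, intervalIntegral.integral_deriv_eq_sub (fun s _ => hd.differentiable (by simp) s)
      (hd'.continuous.intervalIntegrable _ _), (odd_deriv he).map_zero, sub_zero]
  rw [hFTC]
  exact (hg.differentiable (by simp) t).hasDerivAt

end EvenFunction

section Radial

variable {E : Type*} [NormedAddCommGroup E] [InnerProductSpace ℝ E]

/-- Writing the derivative as `ρ k` covers the vertex `x = x₀` as well. -/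
theorem hasFDerivAt_comp_norm_sub {g : ℝ → ℝ} {k : ℝ} {x₀ x : E}
    (hg : HasDerivAt g (‖x - x₀‖ * k) ‖x - x₀‖) :
    HasFDerivAt (fun y => g ‖y - x₀‖) (k • innerSL ℝ (x - x₀)) x := by
  rcases eq_or_ne x x₀ with rfl | hx
  · rw [sub_self, norm_zero, zero_mul, hasDerivAt_iff_isLittleO_nhds_zero] at hg
    rw [hasFDerivAt_iff_isLittleO_nhds_zero, ← Asymptotics.isLittleO_norm_right]
    simpa [Function.comp_def] using hg.comp_tendsto (tendsto_norm_zero (E := E))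
  · have hρ : ‖x - x₀‖ ≠ 0 := norm_ne_zero_iff.2 (sub_ne_zero.2 hx)
    have hsq : HasFDerivAt (fun y => ‖y - x₀‖ ^ 2) (2 • innerSL ℝ (x - x₀)) x := by
      exact (hasStrictFDerivAt_norm_sq (x - x₀)).hasFDerivAt.comp x
        ((hasFDerivAt_id x).sub_const x₀)
    have hnorm := hsq.sqrt (pow_ne_zero 2 hρ)
    simp only [Real.sqrt_sq (norm_nonneg _)] at hnorm
    refine (hg.comp_hasFDerivAt x hnorm).congr_fderiv ?_
    ext v
    simp only [smul_apply, innerSL_apply_apply, smul_eq_mul, nsmul_eq_mul]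
    field_simp
    norm_num

theorem contDiff_comp_norm_sub {g : ℝ → ℝ} (hg : ContDiff ℝ ∞ g) (he : g.Even) (x₀ : E) :
    ContDiff ℝ ∞ fun x => g ‖x - x₀‖ := by
  refine contDiff_infty.2 fun k => ?_
  induction k generalizing g with
  | zero =>
    have := hg.continuous
    exact contDiff_zero.2 (by fun_prop)
  | succ k ih =>
    obtain ⟨h, hh, hev, hd⟩ := exists_hasDerivAt_mul_of_even hg he
    push_cast
    rw [contDiff_succ_iff_hasFDerivAt]
    exact ⟨fun x => h ‖x - x₀‖ • innerSL ℝ (x - x₀),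
      (ih hh hev).smul ((innerSL ℝ).contDiff.comp (contDiff_id.sub contDiff_const)),
      fun x => hasFDerivAt_comp_norm_sub (hd _)⟩

theorem gradient_comp_norm_sub [CompleteSpace E] {g : ℝ → ℝ} {k : ℝ} {x₀ x : E}
    (hg : HasDerivAt g (‖x - x₀‖ * k) ‖x - x₀‖) (c : ℝ) :
    ∇ (fun y => g ‖y - x₀‖ + c) x = k • (x - x₀) := by
  have hgrad : HasGradientAt (fun y => g ‖y - x₀‖ + c) (k • (x - x₀)) x := by
    refine hasGradientAt_iff_hasFDerivAt.2
      (((hasFDerivAt_comp_norm_sub hg).add_const c).congr_fderiv ?_)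
    rw [map_smul]
    rfl
  exact hgrad.gradient

theorem norm_gradient_comp_norm_sub_sq [CompleteSpace E] {g : ℝ → ℝ} {k : ℝ} {x₀ x : E}
    (hg : HasDerivAt g (‖x - x₀‖ * k) ‖x - x₀‖) (c : ℝ) :
    ‖∇ (fun y => g ‖y - x₀‖ + c) x‖ ^ 2 = (‖x - x₀‖ * k) ^ 2 := by
  rw [gradient_comp_norm_sub hg, norm_smul, mul_comm, mul_pow, mul_pow, Real.norm_eq_abs, sq_abs]

theorem iteratedFDeriv_two_comp_norm_sub {g h : ℝ → ℝ} {k : ℝ} {x₀ x : E}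
    (hg : ∀ t, HasDerivAt g (t * h t) t) (hh : HasDerivAt h (‖x - x₀‖ * k) ‖x - x₀‖) (c : ℝ)
    (v : E) : iteratedFDeriv ℝ 2 (fun y => g ‖y - x₀‖ + c) x ![v, v] =
      h ‖x - x₀‖ * ‖v‖ ^ 2 + k * inner ℝ (x - x₀) v ^ 2 := by
  have hfderiv : fderiv ℝ (fun y => g ‖y - x₀‖ + c) =
      fun y => h ‖y - x₀‖ • innerSL ℝ (y - x₀) := funext fun y =>
    ((hasFDerivAt_comp_norm_sub (hg _)).add_const c).fderiv
  have hinner : HasFDerivAt (fun y => innerSL ℝ (y - x₀)) (innerSL ℝ : E →L[ℝ] E →L[ℝ] ℝ) x :=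
    (innerSL ℝ : E →L[ℝ] E →L[ℝ] ℝ).hasFDerivAt.comp x ((hasFDerivAt_id x).sub_const x₀)
  rw [iteratedFDeriv_two_apply, hfderiv, ((hasFDerivAt_comp_norm_sub hh).fun_smul hinner).fderiv]
  have hself : innerSL ℝ v v = ‖v‖ ^ 2 := real_inner_self_eq_norm_sq v
  simp only [Matrix.cons_val_zero, Matrix.cons_val_one, add_apply, smul_apply,
    ContinuousLinearMap.smulRight_apply, innerSL_apply_apply, smul_eq_mul]
  linear_combination h ‖x - x₀‖ * hself

/-- The eigenvalues of the Hessian are `h(ρ)` in the tangential directions and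
`h(ρ) + ρ² k = g''(ρ)` in the radial one. -/
theorem iteratedFDeriv_two_comp_norm_sub_pos {g h : ℝ → ℝ} {k : ℝ} {x₀ x : E}
    (hg : ∀ t, HasDerivAt g (t * h t) t) (hh : HasDerivAt h (‖x - x₀‖ * k) ‖x - x₀‖)
    (htan : 0 < h ‖x - x₀‖) (hrad : 0 < h ‖x - x₀‖ + ‖x - x₀‖ ^ 2 * k) (c : ℝ) {v : E}
    (hv : v ≠ 0) : 0 < iteratedFDeriv ℝ 2 (fun y => g ‖y - x₀‖ + c) x ![v, v] := by
  rw [iteratedFDeriv_two_comp_norm_sub hg hh]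
  have hv' : 0 < ‖v‖ ^ 2 := by positivity
  rcases le_or_gt 0 k with hk | hk
  · positivity
  · have hcs : inner ℝ (x - x₀) v ^ 2 ≤ ‖x - x₀‖ ^ 2 * ‖v‖ ^ 2 := by
      rw [← mul_pow, ← sq_abs]
      exact pow_le_pow_left₀ (abs_nonneg _) (abs_real_inner_le_norm _ _) 2
    calc 0 < (h ‖x - x₀‖ + ‖x - x₀‖ ^ 2 * k) * ‖v‖ ^ 2 := mul_pos hrad hv'
      _ = h ‖x - x₀‖ * ‖v‖ ^ 2 + k * (‖x - x₀‖ ^ 2 * ‖v‖ ^ 2) := by ring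
      _ ≤ h ‖x - x₀‖ * ‖v‖ ^ 2 + k * inner ℝ (x - x₀) v ^ 2 :=
        add_le_add_right (mul_le_mul_of_nonpos_left hcs hk.le) _

end Radial

section Entire

variable {E : Type*} [NormedAddCommGroup E]

theorem norm_add_smul_sub_of_norm_one [NormedSpace ℝ E] {x₀ e : E} (he : ‖e‖ = 1) (t : ℝ) :
    ‖x₀ + t • e - x₀‖ = |t| := by
  rw [add_sub_cancel_left, norm_smul, he, mul_one, Real.norm_eq_abs]

theorem strictConvexOn_of_iteratedFDeriv_two_pos [NormedSpace ℝ E] {s : Set E} (hs : Convex ℝ s)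
    {u : E → ℝ} (hu : ContDiff ℝ 2 u)
    (hpos : ∀ x ∈ s, ∀ v : E, v ≠ 0 → 0 < iteratedFDeriv ℝ 2 u x ![v, v]) :
    StrictConvexOn ℝ s u := by
  refine ⟨hs, fun x hx y hy hxy α β hα hβ hαβ => ?_⟩
  have hsegment : ∀ t : ℝ, HasDerivAt (AffineMap.lineMap x y) (y - x) t := fun t =>
    AffineMap.hasDerivAt_lineMap
  have hdu : ∀ t : ℝ, HasDerivAt (fun t : ℝ => u (AffineMap.lineMap x y t))
      (fderiv ℝ u (AffineMap.lineMap x y t) (y - x)) t := fun t =>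
    (hu.differentiable two_ne_zero _).hasFDerivAt.comp_hasDerivAt t (hsegment t)
  have hddu : ∀ t : ℝ, HasDerivAt (fun t : ℝ => fderiv ℝ u (AffineMap.lineMap x y t) (y - x))
      (fderiv ℝ (fderiv ℝ u) (AffineMap.lineMap x y t) (y - x) (y - x)) t := fun t =>
    (((hu.fderiv_right (m := 1) (by norm_num)).differentiable_one _).hasFDerivAt.comp_hasDerivAt t
      (hsegment t)).clm_apply (hasDerivAt_const t (y - x)) |>.congr_deriv (by simp)
  have hconv : StrictConvexOn ℝ (Icc 0 1) fun t : ℝ => u (AffineMap.lineMap x y t) := by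
    refine strictConvexOn_of_deriv2_pos (convex_Icc 0 1)
      (fun t _ => (hdu t).continuousAt.continuousWithinAt) fun t ht => ?_
    rw [interior_Icc] at ht
    rw [Function.iterate_succ, Function.iterate_one, Function.comp_apply,
      funext fun t => (hdu t).deriv, (hddu t).deriv]
    simpa only [iteratedFDeriv_two_apply, Matrix.cons_val_zero, Matrix.cons_val_one] using
      hpos _ (hs.lineMap_mem hx hy (Ioo_subset_Icc_self ht)) (y - x) (sub_ne_zero.2 hxy.symm)
  have h := hconv.2 (left_mem_Icc.2 zero_le_one) (right_mem_Icc.2 zero_le_one) zero_ne_one hα hβ hαβ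
  have hpoint : AffineMap.lineMap x y (α • (0 : ℝ) + β • (1 : ℝ)) = α • x + β • y := by
    rw [smul_zero, zero_add, smul_eq_mul, mul_one, AffineMap.lineMap_apply_module,
      ← hαβ, add_sub_cancel_right]
  simpa only [hpoint, AffineMap.lineMap_apply_zero, AffineMap.lineMap_apply_one] using h

theorem tendsto_div_norm_cocompact [ProperSpace E] {f : E → ℝ} {C : ℝ}
    (hf : ∀ x, |f x - ‖x‖| ≤ C) : Tendsto (fun x => f x / ‖x‖) (cocompact E) (𝓝 1) := by
  have hnorm : Tendsto (fun x : E => ‖x‖) (cocompact E) atTop := tendsto_norm_cocompact_atTop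
  rw [tendsto_iff_dist_tendsto_zero]
  refine squeeze_zero' (.of_forall fun _ => dist_nonneg) ?_
    (tendsto_const_nhds.div_atTop hnorm : Tendsto (fun x => C / ‖x‖) _ _)
  filter_upwards [hnorm.eventually_gt_atTop 0] with x hx
  rw [Real.dist_eq, div_sub_one hx.ne', abs_div, abs_of_pos hx]
  gcongr
  exact hf x

end Entire

section Soliton

variable {n : ℕ} {x₀ x : EuclideanSpace ℝ (Fin n)}

theorem euclideanDiv_congr {F G : EuclideanSpace ℝ (Fin n) → EuclideanSpace ℝ (Fin n)}
    (h : F =ᶠ[𝓝 x] G) : euclideanDiv F x = euclideanDiv G x := by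
  rw [euclideanDiv, euclideanDiv, h.fderiv_eq]

theorem euclideanDiv_smul_sub {φ : EuclideanSpace ℝ (Fin n) → ℝ}
    {φ' : EuclideanSpace ℝ (Fin n) →L[ℝ] ℝ} (hφ : HasFDerivAt φ φ' x) :
    euclideanDiv (fun y => φ y • (y - x₀)) x = φ' (x - x₀) + n * φ x := by
  have hsum : φ' (x - x₀) = ∑ i, φ' (EuclideanSpace.single i 1) * (x - x₀) i := by
    conv_lhs => rw [← (EuclideanSpace.basisFun (Fin n) ℝ).sum_repr (x - x₀)]
    simp only [map_sum, map_smul, smul_eq_mul, EuclideanSpace.basisFun_repr,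
      EuclideanSpace.basisFun_apply, mul_comm]
  have hprod : HasFDerivAt (fun y => φ y • (y - x₀)) _ x :=
    hφ.fun_smul ((hasFDerivAt_id x).sub_const x₀)
  have htrace : (n : ℝ) * φ x = ∑ _i : Fin n, φ x := by simp
  rw [euclideanDiv, hprod.fderiv, hsum, htrace, ← Finset.sum_add_distrib]
  exact Finset.sum_congr rfl fun i _ => by simp [add_comm]

theorem lorentzField_comp_norm_sub {g : ℝ → ℝ} {k : ℝ}
    (hg : HasDerivAt g (‖x - x₀‖ * k) ‖x - x₀‖) (c : ℝ) :
    lorentzField (fun y => g ‖y - x₀‖ + c) x =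
      ((√(1 - (‖x - x₀‖ * k) ^ 2))⁻¹ * k) • (x - x₀) := by
  rw [lorentzField, norm_gradient_comp_norm_sub_sq hg, gradient_comp_norm_sub hg, smul_smul]

theorem euclideanDiv_lorentzField_comp_norm_sub {g : ℝ → ℝ} {q' : ℝ} (hx : x ≠ x₀)
    (hg : Differentiable ℝ g) (hq : HasDerivAt (momentum ∘ deriv g) q' ‖x - x₀‖) (c : ℝ) :
    euclideanDiv (lorentzField fun y => g ‖y - x₀‖ + c) x =
      q' + ((n : ℝ) - 1) / ‖x - x₀‖ * momentum (deriv g ‖x - x₀‖) := by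
  have hρ : ∀ {y}, y ≠ x₀ → ‖y - x₀‖ ≠ 0 := fun hy => norm_ne_zero_iff.2 (sub_ne_zero.2 hy)
  have hfield : (lorentzField fun y => g ‖y - x₀‖ + c) =ᶠ[𝓝 x]
      fun y => (momentum (deriv g ‖y - x₀‖) / ‖y - x₀‖) • (y - x₀) := by
    filter_upwards [isOpen_ne.mem_nhds hx] with y hy
    have hgy : HasDerivAt g (‖y - x₀‖ * (deriv g ‖y - x₀‖ / ‖y - x₀‖)) ‖y - x₀‖ :=
      (hg _).hasDerivAt.congr_deriv (mul_div_cancel₀ _ (hρ hy)).symm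
    rw [lorentzField_comp_norm_sub hgy, mul_div_cancel₀ _ (hρ hy), momentum]
    congr 1
    ring
  have hquot : HasDerivAt (fun t => momentum (deriv g t) / t) (‖x - x₀‖ *
      ((q' * ‖x - x₀‖ - momentum (deriv g ‖x - x₀‖)) / ‖x - x₀‖ ^ 3)) ‖x - x₀‖ := by
    refine (hq.fun_div (hasDerivAt_id _) (hρ hx)).congr_deriv ?_
    have := hρ hx
    simp only [id, Function.comp_apply]
    field_simp
  rw [euclideanDiv_congr hfield, euclideanDiv_smul_sub (hasFDerivAt_comp_norm_sub hquot),
    smul_apply, innerSL_apply_apply, real_inner_self_eq_norm_sq, smul_eq_mul]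
  have := hρ hx
  field_simp
  ring

theorem IsTranslatingSoliton.isSolitonSolution {u : EuclideanSpace ℝ (Fin n) → ℝ}
    (hu : IsTranslatingSoliton u) : IsSolitonSolution u := by
  obtain ⟨hdiff, hspace, heq⟩ := hu
  replace hdiff := hdiff 0
  replace hspace := hspace 0
  replace heq := heq 0
  simp only [add_zero] at hdiff hspace heq
  refine ⟨hdiff, hspace, fun x => ?_⟩
  have hspeed := (heq x).unique ((hasDerivAt_id 0).const_add (u x))
  have hpos : 0 < 1 - ‖∇ u x‖ ^ 2 :=
    sub_pos.2 (pow_lt_one₀ (norm_nonneg _) (hspace x) two_ne_zero)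
  rw [eq_div_iff (Real.sqrt_pos.2 hpos).ne', mul_comm]
  exact hspeed

/-- The increment `u - u(x₀)` along the line through `x₀` with direction `e`. -/
def lineIncrement (u : EuclideanSpace ℝ (Fin n) → ℝ) (x₀ e : EuclideanSpace ℝ (Fin n)) (t : ℝ) :
    ℝ :=
  u (x₀ + t • e) - u x₀

variable {u : EuclideanSpace ℝ (Fin n) → ℝ} {e : EuclideanSpace ℝ (Fin n)}

theorem IsRadialAbout.eq_lineIncrement (hr : IsRadialAbout u x₀) (he : ‖e‖ = 1) :
    u = fun x => lineIncrement u x₀ e ‖x - x₀‖ + u x₀ := funext fun x => by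
  rw [lineIncrement, sub_add_cancel]
  exact hr _ _ (by rw [norm_add_smul_sub_of_norm_one he, abs_norm])

theorem IsRadialAbout.even_lineIncrement (hr : IsRadialAbout u x₀) (he : ‖e‖ = 1) :
    (lineIncrement u x₀ e).Even := fun t => by
  rw [lineIncrement, lineIncrement, hr (x₀ + -t • e) (x₀ + t • e)
    (by rw [norm_add_smul_sub_of_norm_one he, norm_add_smul_sub_of_norm_one he, abs_neg])]

namespace IsSolitonSolution

theorem contDiff_lineIncrement (hu : IsSolitonSolution u) : ContDiff ℝ 2 (lineIncrement u x₀ e) :=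
  (hu.contDiff.comp (by fun_prop)).sub contDiff_const

theorem norm_gradient_sq_of_isRadialAbout (hu : IsSolitonSolution u) (hr : IsRadialAbout u x₀)
    (he : ‖e‖ = 1) (hx : x ≠ x₀) : ‖∇ u x‖ ^ 2 = deriv (lineIncrement u x₀ e) ‖x - x₀‖ ^ 2 := by
  have hρ : ‖x - x₀‖ ≠ 0 := norm_ne_zero_iff.2 (sub_ne_zero.2 hx)
  have hdiff : Differentiable ℝ (lineIncrement u x₀ e) :=
    hu.contDiff_lineIncrement.differentiable two_ne_zero
  have hnorm := norm_gradient_comp_norm_sub_sq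
    ((hdiff ‖x - x₀‖).hasDerivAt.congr_deriv (mul_div_cancel₀ _ hρ).symm) (u x₀)
  rwa [← hr.eq_lineIncrement he, mul_div_cancel₀ _ hρ] at hnorm

theorem isProfile_lineIncrement (hu : IsSolitonSolution u) (hr : IsRadialAbout u x₀)
    (he : ‖e‖ = 1) : IsProfile n (lineIncrement u x₀ e) := by
  have hg : ContDiff ℝ 2 (lineIncrement u x₀ e) := hu.contDiff_lineIncrement
  have hray : ∀ t > 0, ∃ x, x ≠ x₀ ∧ ‖x - x₀‖ = t := fun t ht => by
    have hdist : ‖x₀ + t • e - x₀‖ = t := by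
      rw [norm_add_smul_sub_of_norm_one he, abs_of_pos ht]
    exact ⟨x₀ + t • e, sub_ne_zero.1 (norm_ne_zero_iff.1 (hdist.trans_ne ht.ne')), hdist⟩
  have hlt : ∀ t > 0, deriv (lineIncrement u x₀ e) t ^ 2 < 1 := fun t ht => by
    obtain ⟨x, hx, rfl⟩ := hray t ht
    rw [← hu.norm_gradient_sq_of_isRadialAbout hr he hx]
    exact pow_lt_one₀ (norm_nonneg _) (hu.spacelike x) two_ne_zero
  refine .of_contDiff hg (by simp [lineIncrement])
    (odd_deriv (hr.even_lineIncrement he)).map_zero hlt fun t ht => ?_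
  have hq := (hasDerivAt_momentum (hlt t ht)).comp t (hg.differentiable_deriv_two t).hasDerivAt
  obtain ⟨x, hx, rfl⟩ := hray t ht
  have hdiv := euclideanDiv_lorentzField_comp_norm_sub hx (hg.differentiable two_ne_zero) hq (u x₀)
  rw [← hr.eq_lineIncrement he, hu.equation, hu.norm_gradient_sq_of_isRadialAbout hr he hx,
    one_div, ← lorentzFactor_momentum (hlt _ ht)] at hdiv
  exact hq.congr_deriv (eq_sub_of_add_eq hdiv.symm)

end IsSolitonSolution

end Soliton

section RadialProfile

variable (m : ℕ)

/-- The solution `q` of `q' + (m / t) q = √(1 + q²)`, `q(0) = 0`: the momentum `r' / √(1 - r'²)` of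
the profile `r` in dimension `m + 1`. -/
noncomputable def radialMomentum : ℝ → ℝ :=
  (exists_isMildSolution m lipschitzWith_lorentzFactor).choose

/-- The smooth even function `q(t) / t`. -/
noncomputable def momentumRatio : ℝ → ℝ := radialMean m (lorentzFactor ∘ radialMomentum m)

/-- The smooth even function `r'(t) / t`. -/
noncomputable def slopeRatio (t : ℝ) : ℝ := momentumRatio m t / lorentzFactor (radialMomentum m t)

/-- The profile `r` in dimension `m + 1`, extended to an even function on `ℝ`. -/
noncomputable def radialProfile (t : ℝ) : ℝ := ∫ s in (0 : ℝ)..t, velocity (radialMomentum m s)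

theorem isMildSolution_radialMomentum : IsMildSolution m lorentzFactor (radialMomentum m) :=
  (exists_isMildSolution m lipschitzWith_lorentzFactor).choose_spec

theorem radialMomentum_eq_mul (t : ℝ) : radialMomentum m t = t * momentumRatio m t :=
  (isMildSolution_radialMomentum m).eq_smul_radialMean t

theorem contDiff_radialMomentum : ContDiff ℝ ∞ (radialMomentum m) :=
  (isMildSolution_radialMomentum m).contDiff contDiff_lorentzFactor

theorem odd_radialMomentum : (radialMomentum m).Odd :=
  (isMildSolution_radialMomentum m).odd lipschitzWith_lorentzFactor even_lorentzFactor

theorem hasDerivAt_radialMomentum (t : ℝ) : HasDerivAt (radialMomentum m)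
    (lorentzFactor (radialMomentum m t) - m * momentumRatio m t) t :=
  (isMildSolution_radialMomentum m).hasDerivAt contDiff_lorentzFactor.continuous t

theorem deriv_radialMomentum_pos {t : ℝ} (ht : 0 ≤ t) : 0 < deriv (radialMomentum m) t :=
  (isMildSolution_radialMomentum m).deriv_pos contDiff_lorentzFactor.continuous
    monotoneOn_lorentzFactor (lorentzFactor_pos 0) ht

theorem contDiff_momentumRatio : ContDiff ℝ ∞ (momentumRatio m) :=
  contDiff_infty_radialMean m (contDiff_lorentzFactor.comp (contDiff_radialMomentum m))

theorem even_momentumRatio : (momentumRatio m).Even :=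
  even_radialMean m (even_lorentzFactor.comp_odd (odd_radialMomentum m))

theorem inv_le_momentumRatio {t : ℝ} (ht : 0 ≤ t) : ((m : ℝ) + 1)⁻¹ ≤ momentumRatio m t := by
  have hmean := radialMean_mono (m := m) ht continuous_const
    (contDiff_lorentzFactor.comp (contDiff_radialMomentum m)).continuous
    fun s _ => one_le_lorentzFactor (radialMomentum m s)
  rwa [radialMean_const, smul_eq_mul, mul_one] at hmean

theorem momentumRatio_pos {t : ℝ} (ht : 0 ≤ t) : 0 < momentumRatio m t :=
  (by positivity : 0 < ((m : ℝ) + 1)⁻¹).trans_le (inv_le_momentumRatio m ht)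

theorem contDiff_slopeRatio : ContDiff ℝ ∞ (slopeRatio m) :=
  (contDiff_momentumRatio m).div (contDiff_lorentzFactor.comp (contDiff_radialMomentum m))
    fun _ => (lorentzFactor_pos _).ne'

theorem even_slopeRatio : (slopeRatio m).Even := fun t => by
  rw [slopeRatio, even_momentumRatio, odd_radialMomentum, even_lorentzFactor, slopeRatio]

theorem slopeRatio_pos {t : ℝ} (ht : 0 ≤ t) : 0 < slopeRatio m t :=
  div_pos (momentumRatio_pos m ht) (lorentzFactor_pos _)

theorem mul_slopeRatio (t : ℝ) : t * slopeRatio m t = velocity (radialMomentum m t) := by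
  rw [slopeRatio, velocity, radialMomentum_eq_mul, mul_div_assoc]

theorem hasDerivAt_radialProfile (t : ℝ) :
    HasDerivAt (radialProfile m) (velocity (radialMomentum m t)) t :=
  ((contDiff_velocity.comp (contDiff_radialMomentum m)).continuous.integral_hasStrictDerivAt
    0 t).hasDerivAt

theorem hasDerivAt_radialProfile_slopeRatio (t : ℝ) :
    HasDerivAt (radialProfile m) (t * slopeRatio m t) t :=
  (hasDerivAt_radialProfile m t).congr_deriv (mul_slopeRatio m t).symm

theorem deriv_radialProfile : deriv (radialProfile m) = velocity ∘ radialMomentum m :=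
  funext fun t => (hasDerivAt_radialProfile m t).deriv

theorem contDiff_radialProfile : ContDiff ℝ ∞ (radialProfile m) := by
  rw [contDiff_infty_iff_deriv, deriv_radialProfile]
  exact ⟨fun t => (hasDerivAt_radialProfile m t).differentiableAt,
    contDiff_velocity.comp (contDiff_radialMomentum m)⟩

theorem even_radialProfile : (radialProfile m).Even := fun t => by
  have h := intervalIntegral.integral_comp_neg (a := 0) (b := t)
    fun s => velocity (radialMomentum m s)
  simp only [odd_radialMomentum m _, odd_velocity _, intervalIntegral.integral_neg, neg_zero] at h
  rw [radialProfile, intervalIntegral.integral_symm, ← h, neg_neg, radialProfile]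

theorem radialProfile_zero : radialProfile m 0 = 0 := intervalIntegral.integral_same

theorem isProfile_radialProfile : IsProfile (m + 1) (radialProfile m) := by
  refine .of_contDiff ((contDiff_radialProfile m).of_le (by norm_cast)) (radialProfile_zero m) ?_
    (fun t _ => ?_) fun t ht => ?_ <;> rw [deriv_radialProfile]
  · rw [Function.comp_apply, ← mul_slopeRatio, zero_mul]
  · exact velocity_sq_lt_one _
  · have hcomp : momentum ∘ velocity ∘ radialMomentum m = radialMomentum m :=
      funext fun s => momentum_velocity _
    rw [hcomp, Function.comp_apply, momentum_velocity, Nat.cast_add_one, add_sub_cancel_right]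
    exact (isMildSolution_radialMomentum m).hasDerivAt_of_ne_zero
      contDiff_lorentzFactor.continuous ht.ne'

theorem isSolitonSolution_radialProfile (x₀ : EuclideanSpace ℝ (Fin (m + 1))) (c : ℝ) :
    IsSolitonSolution fun x => radialProfile m ‖x - x₀‖ + c := by
  have hsq : ∀ x, ‖∇ (fun x => radialProfile m ‖x - x₀‖ + c) x‖ ^ 2 =
      velocity (radialMomentum m ‖x - x₀‖) ^ 2 := fun x => by
    rw [norm_gradient_comp_norm_sub_sq (hasDerivAt_radialProfile_slopeRatio m _), mul_slopeRatio]
  refine ⟨?_, fun x => ?_, fun x => ?_⟩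
  · exact ((contDiff_comp_norm_sub (contDiff_radialProfile m) (even_radialProfile m) x₀).add
      contDiff_const).of_le (by norm_cast)
  · rw [← sq_lt_one_iff₀ (norm_nonneg _), hsq]
    exact velocity_sq_lt_one _
  · have hfield : (lorentzField fun x => radialProfile m ‖x - x₀‖ + c) =
        fun x => momentumRatio m ‖x - x₀‖ • (x - x₀) := funext fun x => by
      rw [lorentzField_comp_norm_sub (hasDerivAt_radialProfile_slopeRatio m _), mul_slopeRatio,
        sqrt_one_sub_velocity_sq, inv_inv, slopeRatio, mul_div_cancel₀ _ (lorentzFactor_pos _).ne']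
    obtain ⟨k, -, -, hk⟩ :=
      exists_hasDerivAt_mul_of_even (contDiff_momentumRatio m) (even_momentumRatio m)
    have hode : momentumRatio m ‖x - x₀‖ + ‖x - x₀‖ * (‖x - x₀‖ * k ‖x - x₀‖) =
        lorentzFactor (radialMomentum m ‖x - x₀‖) - m * momentumRatio m ‖x - x₀‖ := by
      have hprod := (hasDerivAt_id ‖x - x₀‖).fun_mul (hk ‖x - x₀‖)
      simp only [id, one_mul, ← radialMomentum_eq_mul] at hprod
      exact hprod.unique (hasDerivAt_radialMomentum m _)
    rw [hfield, euclideanDiv_smul_sub (hasFDerivAt_comp_norm_sub (hk _)), hsq,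
      sqrt_one_sub_velocity_sq, one_div, inv_inv, smul_apply, innerSL_apply_apply,
      real_inner_self_eq_norm_sq, smul_eq_mul]
    push_cast
    linear_combination hode

theorem div_sqrt_le_deriv_radialProfile {t : ℝ} (ht : 0 ≤ t) :
    t / √(((m : ℝ) + 1) ^ 2 + t ^ 2) ≤ deriv (radialProfile m) t := by
  have hm : (0 : ℝ) < m + 1 := by positivity
  have hfactor : (m + 1) * lorentzFactor (t * ((m : ℝ) + 1)⁻¹) = √(((m : ℝ) + 1) ^ 2 + t ^ 2) := by
    rw [lorentzFactor, ← Real.sqrt_sq hm.le, ← Real.sqrt_mul (sq_nonneg _), Real.sqrt_sq hm.le]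
    congr 1
    field_simp
  calc t / √(((m : ℝ) + 1) ^ 2 + t ^ 2) = velocity (t * ((m : ℝ) + 1)⁻¹) := by
        rw [← hfactor, velocity, ← div_eq_mul_inv, div_div]
    _ ≤ velocity (radialMomentum m t) := by
        refine strictMono_velocity.monotone ?_
        rw [radialMomentum_eq_mul]
        exact mul_le_mul_of_nonneg_left (inv_le_momentumRatio m ht) ht
    _ = deriv (radialProfile m) t := by rw [deriv_radialProfile, Function.comp_apply]

theorem deriv_radialProfile_lt_one (t : ℝ) : deriv (radialProfile m) t < 1 := by
  rw [deriv_radialProfile]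
  exact (abs_lt.1 ((sq_lt_one_iff_abs_lt_one _).1 (velocity_sq_lt_one _))).2

theorem hasDerivAt_deriv_radialProfile (t : ℝ) : HasDerivAt (deriv (radialProfile m))
    ((lorentzFactor (radialMomentum m t) ^ 3)⁻¹ * deriv (radialMomentum m) t) t := by
  rw [deriv_radialProfile]
  exact (hasDerivAt_velocity _).comp t (hasDerivAt_radialMomentum m t).differentiableAt.hasDerivAt

theorem deriv_deriv_radialProfile_pos {t : ℝ} (ht : 0 ≤ t) :
    0 < deriv (deriv (radialProfile m)) t := by
  rw [(hasDerivAt_deriv_radialProfile m t).deriv]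
  exact mul_pos (inv_pos.2 (pow_pos (lorentzFactor_pos _) 3)) (deriv_radialMomentum_pos m ht)

theorem deriv_deriv_radialProfile_le_one {t : ℝ} (ht : 0 ≤ t) :
    deriv (deriv (radialProfile m)) t ≤ 1 := by
  rw [(hasDerivAt_deriv_radialProfile m t).deriv, inv_mul_le_iff₀ (pow_pos (lorentzFactor_pos _) 3),
    mul_one, (hasDerivAt_radialMomentum m t).deriv]
  calc lorentzFactor (radialMomentum m t) - m * momentumRatio m t
      ≤ lorentzFactor (radialMomentum m t) :=
        sub_le_self _ (mul_nonneg m.cast_nonneg (momentumRatio_pos m ht).le)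
    _ ≤ lorentzFactor (radialMomentum m t) ^ 3 :=
        le_self_pow₀ (one_le_lorentzFactor _) three_ne_zero

theorem iteratedFDeriv_two_radialProfile_pos {E : Type*} [NormedAddCommGroup E]
    [InnerProductSpace ℝ E] (x₀ x : E) (c : ℝ) {v : E} (hv : v ≠ 0) :
    0 < iteratedFDeriv ℝ 2 (fun y => radialProfile m ‖y - x₀‖ + c) x ![v, v] := by
  obtain ⟨k, -, -, hk⟩ := exists_hasDerivAt_mul_of_even (contDiff_slopeRatio m) (even_slopeRatio m)
  refine iteratedFDeriv_two_comp_norm_sub_pos (hasDerivAt_radialProfile_slopeRatio m) (hk _)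
    (slopeRatio_pos m (norm_nonneg _)) ?_ c hv
  have hprod := (hasDerivAt_id ‖x - x₀‖).fun_mul (hk ‖x - x₀‖)
  have hpos := deriv_deriv_radialProfile_pos m (norm_nonneg (x - x₀))
  rw [funext fun t => (hasDerivAt_radialProfile_slopeRatio m t).deriv] at hpos
  simp only [id, one_mul] at hprod
  rwa [hprod.deriv, ← mul_assoc, ← sq] at hpos

theorem radialProfile_le {t : ℝ} (ht : 0 ≤ t) : radialProfile m t ≤ t := by
  have hanti : Antitone fun s => radialProfile m s - s :=
    antitone_of_deriv_nonpos
      (fun s => ((hasDerivAt_radialProfile m s).sub (hasDerivAt_id s)).differentiableAt) fun s => by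
        rw [((hasDerivAt_radialProfile m s).fun_sub (hasDerivAt_id' s)).deriv]
        have := deriv_radialProfile_lt_one m s
        rw [deriv_radialProfile, Function.comp_apply] at this
        linarith
  simpa [radialProfile_zero] using hanti ht

theorem sub_le_radialProfile {t : ℝ} (ht : 0 ≤ t) : t - (m + 1) ≤ radialProfile m t := by
  let S : ℝ → ℝ := fun s => √(((m : ℝ) + 1) ^ 2 + s ^ 2)
  have hS : ∀ s, HasDerivAt S (s / S s) s := fun s => by
    have hpos : 0 < ((m : ℝ) + 1) ^ 2 + s ^ 2 := by positivity
    refine (((hasDerivAt_pow 2 s).const_add _).sqrt hpos.ne').congr_deriv ?_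
    rw [Nat.cast_ofNat, Nat.add_one_sub_one, pow_one, mul_div_mul_left _ _ two_ne_zero]
  have hmono : MonotoneOn (fun s => radialProfile m s - S s) (Ici 0) := by
    have hd : ∀ s, HasDerivAt (fun s => radialProfile m s - S s)
        (deriv (radialProfile m) s - s / S s) s := fun s =>
      (hasDerivAt_radialProfile m s).differentiableAt.hasDerivAt.sub (hS s)
    refine monotoneOn_of_deriv_nonneg (convex_Ici 0)
      (fun s _ => (hd s).continuousAt.continuousWithinAt)
      (fun s _ => (hd s).differentiableAt.differentiableWithinAt) fun s hs => ?_
    rw [interior_Ici] at hs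
    rw [(hd s).deriv, sub_nonneg]
    exact div_sqrt_le_deriv_radialProfile m (le_of_lt hs)
  have hS0 : S 0 = m + 1 := by
    simp only [S, zero_pow two_ne_zero, add_zero]
    exact Real.sqrt_sq (by positivity)
  have hSt : t ≤ S t := Real.le_sqrt_of_sq_le (le_add_of_nonneg_left (sq_nonneg _))
  have hle : radialProfile m 0 - S 0 ≤ radialProfile m t - S t := hmono self_mem_Ici ht ht
  rw [radialProfile_zero, hS0] at hle
  linarith

theorem tendsto_radialProfile_div_norm {E : Type*} [NormedAddCommGroup E] [ProperSpace E] (x₀ : E)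
    (c : ℝ) : Tendsto (fun x => (radialProfile m ‖x - x₀‖ + c) / ‖x‖) (cocompact E) (𝓝 1) := by
  refine tendsto_div_norm_cocompact (C := m + 1 + |c| + ‖x₀‖) fun x => ?_
  have hprofile : |radialProfile m ‖x - x₀‖ - ‖x - x₀‖| ≤ m + 1 := by
    have hle := radialProfile_le m (norm_nonneg (x - x₀))
    have hge := sub_le_radialProfile m (norm_nonneg (x - x₀))
    exact abs_le.2 ⟨by linarith, by linarith [m.cast_nonneg (α := ℝ)]⟩
  have hshift : |‖x - x₀‖ - ‖x‖| ≤ ‖x₀‖ := by simpa using abs_norm_sub_norm_le (x - x₀) x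
  calc |radialProfile m ‖x - x₀‖ + c - ‖x‖|
      = |(radialProfile m ‖x - x₀‖ - ‖x - x₀‖) + c + (‖x - x₀‖ - ‖x‖)| := by ring_nf
    _ ≤ |radialProfile m ‖x - x₀‖ - ‖x - x₀‖| + |c| + |‖x - x₀‖ - ‖x‖| := abs_add_three _ _ _
    _ ≤ m + 1 + |c| + ‖x₀‖ := by gcongr

variable {m} in
theorem IsSolitonSolution.eq_radialProfile {u : EuclideanSpace ℝ (Fin (m + 1)) → ℝ}
    {x₀ : EuclideanSpace ℝ (Fin (m + 1))} (hu : IsSolitonSolution u) (hr : IsRadialAbout u x₀) :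
    u = fun x => radialProfile m ‖x - x₀‖ + u x₀ := by
  have he : ‖(EuclideanSpace.single 0 1 : EuclideanSpace ℝ (Fin (m + 1)))‖ = 1 := by simp
  have heq := (hu.isProfile_lineIncrement hr he).eqOn m.succ_pos (isProfile_radialProfile m)
  conv_lhs => rw [hr.eq_lineIncrement he]
  exact funext fun x => congrArg (· + u x₀) (heq (norm_nonneg (x - x₀)))

end RadialProfile

theorem theorem1p1 (n : ℕ) (hn : 1 ≤ n) :
    ∃ r : ℝ → ℝ,
      -- existence and uniqueness for the singular initial value problem on `[0, ∞)`
      IsProfile n r ∧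
      (∀ s : ℝ → ℝ, IsProfile n s → EqOn s r (Ici 0)) ∧
      -- every radially symmetric solution is given by `r`, and `r` gives such solutions
      (∀ (u : EuclideanSpace ℝ (Fin n) → ℝ) (x₀ : EuclideanSpace ℝ (Fin n)),
        IsSolitonSolution u → IsRadialAbout u x₀ → ∀ x, u x = r ‖x - x₀‖ + u x₀) ∧
      (∀ (x₀ : EuclideanSpace ℝ (Fin n)) (c : ℝ),
        IsSolitonSolution (fun x => r ‖x - x₀‖ + c)) ∧
      -- regularity and estimates for `r`
      ContDiffOn ℝ ∞ r (Ici 0) ∧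
      (∀ t ∈ Ici (0 : ℝ), t / Real.sqrt ((n : ℝ) ^ 2 + t ^ 2) ≤ derivWithin r (Ici 0) t ∧
        derivWithin r (Ici 0) t < 1) ∧
      (∀ t ∈ Ici (0 : ℝ), 0 < iteratedDerivWithin 2 r (Ici 0) t ∧
        iteratedDerivWithin 2 r (Ici 0) t ≤ 1) ∧
      -- rotationally symmetric solitons are smooth, strictly convex and of linear growth
      (∀ (u : EuclideanSpace ℝ (Fin n) → ℝ) (x₀ : EuclideanSpace ℝ (Fin n)),
        IsTranslatingSoliton u → IsRadialAbout u x₀ →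
          ContDiff ℝ ∞ u ∧
          StrictConvexOn ℝ univ u ∧
          (∀ x v : EuclideanSpace ℝ (Fin n), v ≠ 0 → 0 < iteratedFDeriv ℝ 2 u x ![v, v]) ∧
          Tendsto (fun x => u x / ‖x‖) (cocompact (EuclideanSpace ℝ (Fin n))) (𝓝 1)) ∧
      -- and unique up to a translation of `ℝⁿ⁺¹`
      (∀ (u w : EuclideanSpace ℝ (Fin n) → ℝ) (x₀ y₀ : EuclideanSpace ℝ (Fin n)),
        IsTranslatingSoliton u → IsRadialAbout u x₀ →
        IsTranslatingSoliton w → IsRadialAbout w y₀ →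
          ∃ (a : EuclideanSpace ℝ (Fin n)) (c : ℝ), ∀ x, w x = u (x - a) + c) := by
  obtain ⟨m, rfl⟩ : ∃ m, n = m + 1 := Nat.exists_eq_add_of_le' hn
  have hr := isProfile_radialProfile m
  have hsmooth := contDiff_radialProfile m
  refine ⟨radialProfile m, hr, fun s hs => hs.eqOn hn hr,
    fun u x₀ hu hrad => congrFun (hu.eq_radialProfile hrad),
    isSolitonSolution_radialProfile m, hsmooth.contDiffOn, fun t ht => ?_, fun t ht => ?_,
    fun u x₀ hu hrad => ?_, fun u w x₀ y₀ hu hurad hw hwrad => ⟨y₀ - x₀, w y₀ - u x₀, fun x => ?_⟩⟩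
  · rw [derivWithin_Ici_eq_deriv (hsmooth.differentiable (by simp)) ht, Nat.cast_add_one]
    exact ⟨div_sqrt_le_deriv_radialProfile m ht, deriv_radialProfile_lt_one m t⟩
  · rw [iteratedDerivWithin_two_Ici_eq_deriv (hsmooth.of_le (by norm_cast)) ht]
    exact ⟨deriv_deriv_radialProfile_pos m ht, deriv_deriv_radialProfile_le_one m ht⟩
  · have hC2 := hu.isSolitonSolution.contDiff
    rw [hu.isSolitonSolution.eq_radialProfile hrad] at hC2 ⊢
    have hhess := fun x v => iteratedFDeriv_two_radialProfile_pos m x₀ x (u x₀) (v := v)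
    exact ⟨(contDiff_comp_norm_sub hsmooth (even_radialProfile m) x₀).add contDiff_const,
      strictConvexOn_of_iteratedFDeriv_two_pos convex_univ hC2 fun x _ => hhess x, hhess,
      tendsto_radialProfile_div_norm m x₀ (u x₀)⟩
  · rw [congrFun (hw.isSolitonSolution.eq_radialProfile hwrad) x,
      congrFun (hu.isSolitonSolution.eq_radialProfile hurad) (x - (y₀ - x₀)),
      sub_sub, sub_add_cancel]
    ring
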